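/- Call a group \(G\) torsion-free if \(x^n\neq 1\) for all \(x\in G\setminus\{1\}\) and all integers \(n\ge 1\). Let \(\mathcal G\) be the set of all triples \((m,i,e)\in \mathbb N^{\mathbb N\times\mathbb N}\times\mathbb N^{\mathbb N}\times\mathbb N\) that are the multiplication, the inversion and the identity element of a group with underlying set \(\mathbb N\), with the topology induced by the product of the discrete topologies, and let \(\mathcal G_{\mathrm{tf}}\subseteq\mathcal G\) be the subspace of the torsion-free groups. A property of groups holds for a *generic countable torsion-free group* if the set of \(G\in\mathcal G_{\mathrm{tf}}\) that have it is comeager, i.e. contains a countable intersection of dense open subsets of \(\mathcal G_{\mathrm{tf}}\). For a group \(G\) and \(f,g\in G\), write \([f,g]=fgf^{-1}g^{-1}\), and let \(C_G(g)\) be the centralizer of \(g\). Say that \(g\) is *algebraically disjoint* from \(f\) if for every \(h\in G\) with \([f,h]\neq 1\) there are \(a,b\in C_G(g)\) such that \(1\neq[a,[b,h]]\in C_G(g)\). Put \(S_f=\{g^{12} : g\in G \text{ algebraically disjoint from } f\}\). **Proposition.** Let \(G\) be a generic countable torsion-free group. Then for all non-trivial \(f,g\in G\) with \([f,g]=1\),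 the element \(f\) is algebraically disjoint from \(g\). Moreover, \(S_f=C_G(f)\) for every \(f\in G\). -/

import Mathlib

open scoped commutatorElement

/-- The space of all candidate data (multiplication, inversion, identity) for a group with
underlying set `ℕ`; it carries the product topology of discrete factors. -/
abbrev GroupData : Type := (ℕ × ℕ → ℕ) × (ℕ → ℕ) × ℕ

/-- The data satisfy the group axioms. -/
structure GroupData.IsGroup (x : GroupData) : Prop where
  mul_assoc : ∀ a b c : ℕ, x.1 (x.1 (a, b), c) = x.1 (a, x.1 (b, c))
  one_mul : ∀ a : ℕ, x.1 (x.2.2, a) = a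
  mul_one : ∀ a : ℕ, x.1 (a, x.2.2) = a
  inv_mul : ∀ a : ℕ, x.1 (x.2.1 a, a) = x.2.2
  mul_inv : ∀ a : ℕ, x.1 (a, x.2.1 a) = x.2.2

/-- The space of enumerated (countably infinite) groups, with the subspace topology. -/
abbrev EnumeratedGroup : Type := {x : GroupData // x.IsGroup}

/-- The underlying set `ℕ` of an enumerated group, as a type carrying that group structure. -/
def EnumeratedGroup.Carrier (_G : EnumeratedGroup) : Type := ℕ

instance EnumeratedGroup.instGroupCarrier (G : EnumeratedGroup) : Group G.Carrier where
  mul a b := G.1.1 (a, b)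
  one := G.1.2.2
  inv a := G.1.2.1 a
  mul_assoc := G.2.mul_assoc
  one_mul := G.2.one_mul
  mul_one := G.2.mul_one
  inv_mul_cancel := G.2.inv_mul

/-- A group is torsion-free if no non-trivial element has a trivial positive power. (For
non-abelian groups this is weaker than injectivity of all the power maps.) -/
def TorsionFreeGroup (G : Type*) [Group G] : Prop :=
  ∀ x : G, x ≠ 1 → ∀ n : ℕ, 0 < n → x ^ n ≠ 1

/-- The space of enumerated torsion-free groups, with the subspace topology. -/
abbrev TorsionFreeEnumeratedGroup : Type :=
  {G : EnumeratedGroup // TorsionFreeGroup G.Carrier}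

/-- `g` is algebraically disjoint from `f`. -/
def AlgebraicallyDisjointFrom {G : Type*} [Group G] (g f : G) : Prop :=
  ∀ h : G, ⁅f, h⁆ ≠ 1 →
    ∃ a ∈ Subgroup.centralizer {g}, ∃ b ∈ Subgroup.centralizer {g},
      ⁅a, ⁅b, h⁆⁆ ≠ 1 ∧ ⁅a, ⁅b, h⁆⁆ ∈ Subgroup.centralizer {g}

/-- The set `S_f` of twelfth powers of the elements that are algebraically disjoint from `f`. -/
def rubinSet {G : Type*} [Group G] (f : G) : Set G :=
  {x : G | ∃ g : G, AlgebraicallyDisjointFrom g f ∧ g ^ 12 = x}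

/-- A property of groups is generic among torsion-free countable groups if the enumerated
torsion-free groups that have it form a comeager set, i.e. one that contains a countable
intersection of dense open subsets of the space of enumerated torsion-free groups. -/
def GenericTorsionFree (P : ∀ (G : Type) [Group G], Prop) : Prop :=
  {G : TorsionFreeEnumeratedGroup | P G.1.Carrier} ∈ residual TorsionFreeEnumeratedGroup

/-! A condition on a pair of elements that is open and can be realized in some countable
torsion-free extension of any countable torsion-free group holds generically: basic neighbourhoods
see only finitely many table entries, so the extension can be enumerated inside any of them
(`eventually_residual_of_extension`). Two extensions are needed. Amalgamating two copies of `G`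
adjoins an `n`-th root of `x` that commutes with `f`, when `f` and `x` commute
(`exists_root_extension`). An iterated wreath product gives the required `a`, `b` for `f` whenever
`h` is not a power of `f` (`exists_commutator_extension`). If `f` and `g` commute and `h` does not
commute with `g`, then `h` is not a power of `f`; hence `f` is disjoint from `g`. So a 12th root,
commuting with `f`, of an element of the centralizer of `f` puts that element into `S_f`. The
converse inclusion holds in every group (`commutator_pow_eq_one`). -/

/-! ### Torsion in amalgamated products -/

section Amalgam

open Monoid

variable {ι H : Type*} {G : ι → Type*} [∀ i, Group (G i)] [Group H] {φ : ∀ i, H →* G i}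

/-- The element of an amalgamated product represented by a list of letters. -/
def Monoid.PushoutI.listProd (φ : ∀ i, H →* G i) (l : List (Σ i, G i)) : PushoutI φ :=
  (l.map fun p => PushoutI.of p.1 p.2).prod

namespace Monoid.PushoutI

theorem listProd_append (l l' : List (Σ i, G i)) :
    listProd φ (l ++ l') = listProd φ l * listProd φ l' := by
  simp [listProd]

theorem listProd_cons (p : Σ i, G i) (l : List (Σ i, G i)) :
    listProd φ (p :: l) = of p.1 p.2 * listProd φ l := by
  simp [listProd]

theorem listProd_surjective [Nonempty ι] : Function.Surjective (listProd φ) := by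
  intro y
  induction y using PushoutI.induction_on with
  | of i g => exact ⟨[⟨i, g⟩], by simp [listProd]⟩
  | base h =>
    obtain ⟨i⟩ := ‹Nonempty ι›
    exact ⟨[⟨i, φ i h⟩], by simp [listProd, of_apply_eq_base]⟩
  | mul x y hx hy =>
    obtain ⟨l, rfl⟩ := hx
    obtain ⟨l', rfl⟩ := hy
    exact ⟨l ++ l', listProd_append l l'⟩

theorem isConj_listProd_rotate (l l' : List (Σ i, G i)) :
    IsConj (listProd φ (l ++ l')) (listProd φ (l' ++ l)) := by
  rw [isConj_iff]
  exact ⟨(listProd φ l)⁻¹, by simp [listProd_append]⟩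

theorem listProd_flatten_replicate (n : ℕ) (l : List (Σ i, G i)) :
    listProd φ (List.replicate n l).flatten = listProd φ l ^ n := by
  induction n with
  | zero => simp [listProd]
  | succ n ih => rw [List.replicate_succ, List.flatten_cons, listProd_append, ih, pow_succ']

/-- A nonempty list with distinct adjacent indices and all letters outside of the amalgamated
subgroup represents a nontrivial element. -/
theorem listProd_ne_one (hφ : ∀ i, Function.Injective (φ i)) {l : List (Σ i, G i)} (hl : l ≠ [])
    (hr : ∀ p ∈ l, p.2 ∉ (φ p.1).range) (hc : l.IsChain fun p q => p.1 ≠ q.1) :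
    listProd φ l ≠ 1 := by
  intro h
  let w : CoprodI.Word G := ⟨l, fun p hp h1 => hr p hp (h1 ▸ one_mem _), hc⟩
  have hw : ofCoprodI (φ := φ) w.prod = 1 := by
    rw [← h]
    simp [w, CoprodI.Word.prod, listProd, map_list_prod, Function.comp_def]
  have := Reduced.eq_empty_of_mem_range hφ (w := w) hr (hw ▸ one_mem _)
  exact hl (congrArg CoprodI.Word.toList this)

/-- The product of a list that begins with two letters of the same factor, or with a letter of the
amalgamated subgroup, is the product of a list with one letter less. -/
theorem exists_shorter {p q : Σ i, G i} (h : p.1 = q.1 ∨ p.2 ∈ (φ p.1).range)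
    (l : List (Σ i, G i)) :
    ∃ r : Σ i, G i, listProd φ (p :: q :: l) = listProd φ (r :: l) := by
  obtain ⟨i, x⟩ := p
  obtain ⟨j, y⟩ := q
  rcases h with h | ⟨c, hc⟩
  · obtain rfl : i = j := h
    exact ⟨⟨i, x * y⟩, by simp [listProd_cons, mul_assoc]⟩
  · have hc : φ i c = x := hc
    subst hc
    exact ⟨⟨j, φ j c * y⟩, by simp [listProd_cons, mul_assoc, of_apply_eq_base]⟩

/-- An element of finite order of an amalgamated product is conjugate into a factor. -/
theorem exists_isConj_of_pow_eq_one [Nonempty ι] (hφ : ∀ i, Function.Injective (φ i))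
    {y : PushoutI φ} {n : ℕ} (hn : 0 < n) (hy : y ^ n = 1) :
    ∃ (i : ι) (g : G i), IsConj y (of i g) := by
  classical
  -- Take a shortest list representing a conjugate of `y`. With two or more letters it is cyclically
  -- reduced, which will make its powers reduced.
  have hex : ∃ k, ∃ l : List (Σ i, G i), l.length = k ∧ IsConj y (listProd φ l) := by
    obtain ⟨l, rfl⟩ := listProd_surjective (φ := φ) y
    exact ⟨_, l, rfl, IsConj.refl _⟩
  obtain ⟨l, hlen, hconj⟩ := Nat.find_spec hex
  have hmin : ∀ l' : List (Σ i, G i), IsConj y (listProd φ l') → l.length ≤ l'.length :=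
    fun l' h => hlen ▸ Nat.find_min' hex ⟨l', rfl, h⟩
  have hcons : ∀ p q l', IsConj y (listProd φ (p :: q :: l')) → l'.length + 2 = l.length →
      p.1 ≠ q.1 ∧ p.2 ∉ (φ p.1).range := by
    intro p q l' h hl
    by_contra hpq
    obtain ⟨r, hr⟩ := exists_shorter (φ := φ) (p := p) (q := q) (by tauto) l'
    have := hmin _ (hr ▸ h)
    simp only [List.length_cons] at this
    omega
  match l, hlen, hconj, hmin, hcons with
  | [], _, hconj, _, _ =>
    obtain ⟨i⟩ := ‹Nonempty ι›
    exact ⟨i, 1, by simpa [listProd] using hconj⟩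
  | [p], _, hconj, _, _ => exact ⟨p.1, p.2, by simpa [listProd] using hconj⟩
  | p₀ :: q₀ :: l₀, _, hconj, _, hcons =>
    exfalso
    set l := p₀ :: q₀ :: l₀ with hl
    -- Rotation preserves the length and the conjugacy class, so minimality applies with any letter
    -- `p` in front; `q` is its cyclic successor.
    have hrot : ∀ s t p, l = s ++ p :: t → ∃ q t', t ++ s = q :: t' ∧
        p.1 ≠ q.1 ∧ p.2 ∉ (φ p.1).range := by
      intro s t p hst
      have hlen := congrArg List.length hst
      match hts : t ++ s with
      | [] =>
        have := congrArg List.length hts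
        simp only [hl, List.length_append, List.length_cons, List.length_nil] at this hlen
        omega
      | q :: t' =>
        have h' := congrArg List.length hts
        refine ⟨q, t', rfl, hcons p q t' ?_ ?_⟩
        · rw [← hts, ← List.cons_append]
          exact hconj.trans (hst ▸ isConj_listProd_rotate s (p :: t))
        · simp at h' hlen
          omega
    have hr : ∀ p ∈ l, p.2 ∉ (φ p.1).range := by
      intro p hp
      obtain ⟨s, t, hst⟩ := List.append_of_mem hp
      obtain ⟨q, t', -, -, h⟩ := hrot s t p hst
      exact h
    have hchain : l.IsChain fun p q => p.1 ≠ q.1 := by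
      rw [List.isChain_iff_forall_rel_of_append_cons_cons]
      intro p q s t hst
      obtain ⟨q', t', hq, h, -⟩ := hrot s (q :: t) p hst
      simp only [List.cons_append, List.cons.injEq] at hq
      exact hq.1 ▸ h
    have hcyc : ∀ p ∈ l.getLast?, ∀ q ∈ l.head?, p.1 ≠ q.1 := by
      intro p hp q hq
      obtain ⟨s, hs⟩ := List.mem_getLast?_eq_getLast hp |> fun ⟨hne, h⟩ =>
        (⟨l.dropLast, by rw [h, List.dropLast_append_getLast]⟩ : ∃ s, l = s ++ [p])
      obtain ⟨q', t', hq', h, -⟩ := hrot s [] p hs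
      simp only [List.nil_append] at hq'
      subst hq'
      rw [hs] at hq
      simp at hq
      exact hq ▸ h
    refine listProd_ne_one hφ (l := (List.replicate n l).flatten) ?_ ?_ ?_ ?_
    · simp [hl, hn.ne']
    · intro p hp
      simp only [List.mem_flatten, List.mem_replicate] at hp
      obtain ⟨_, ⟨-, rfl⟩, hp⟩ := hp
      exact hr p hp
    · rw [List.isChain_flatten (by simp [hl])]
      refine ⟨fun l' hl' => (List.eq_of_mem_replicate hl') ▸ hchain, ?_⟩
      exact List.isChain_replicate_of_rel n hcyc
    · rw [listProd_flatten_replicate]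
      obtain ⟨c, hc⟩ := isConj_iff.1 hconj
      rw [← hc, conj_pow, hy]
      simp

theorem torsionFreeGroup [Nonempty ι] (hφ : ∀ i, Function.Injective (φ i))
    (hG : ∀ i, TorsionFreeGroup (G i)) : TorsionFreeGroup (PushoutI φ) := by
  intro y hy n hn hyn
  obtain ⟨i, g, h⟩ := exists_isConj_of_pow_eq_one hφ hn hyn
  obtain ⟨c, hc⟩ := isConj_iff.1 h
  have hg : (of i (g ^ n) : PushoutI φ) = 1 := by
    rw [map_pow, ← hc, conj_pow, hyn]
    simp
  have hg1 : g = 1 := by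
    by_contra hne
    exact hG i g hne n hn (of_injective hφ i (by rw [hg, map_one]))
  rw [hg1, map_one] at hc
  exact hy (by simpa using hc)

end Monoid.PushoutI

end Amalgam

/-! ### Adjoining roots -/

/-- In a torsion-free extension of a torsion-free group, any element has a root that commutes with a
given element of its centralizer. -/
theorem TorsionFreeGroup.exists_root_extension {G : Type} [Group G] [Countable G]
    (hG : TorsionFreeGroup G) {f x : G} (hfx : Commute f x) {n : ℕ} (hn : 0 < n) :
    ∃ (H : Type) (_ : Group H) (_ : Countable H) (i : G →* H),
      TorsionFreeGroup H ∧ Function.Injective i ∧ ∃ y : H, y ^ n = i x ∧ Commute (i f) y := by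
  have hcomm : ∀ a ∈ ({f, x} : Set G), ∀ b ∈ ({f, x} : Set G), a * b = b * a := by
    rintro a (rfl | rfl) b (rfl | rfl)
    exacts [rfl, hfx, hfx.symm, rfl]
  let A := Subgroup.closure ({f, x} : Set G)
  have hA : IsMulCommutative A := Subgroup.isMulCommutative_closure hcomm
  let _ : CommGroup A := { A.toGroup with mul_comm := hA.is_comm.comm }
  let f' : A := ⟨f, Subgroup.subset_closure (by simp)⟩
  let x' : A := ⟨x, Subgroup.subset_closure (by simp)⟩
  -- Each `a` in `A` of the `false` copy is glued to `a ^ n` in the `true` copy. Thus `x` of the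
  -- `true` copy becomes an `n`-th root of the original `x`, and the original `f` becomes `f ^ n`
  -- there.
  let φ : Bool → (A →* G) := fun c => if c then A.subtype.comp (powMonoidHom n) else A.subtype
  have hpow : Function.Injective (powMonoidHom n : A →* A) := by
    rw [injective_iff_map_eq_one]
    intro a ha
    by_contra hne
    refine hG a.1 (fun h => hne (Subtype.ext h)) n hn ?_
    exact congrArg Subtype.val (ha : a ^ n = 1)
  have hφ : ∀ c, Function.Injective (φ c) := by
    rintro (_ | _)
    · exact A.subtype_injective
    · exact A.subtype_injective.comp hpow
  have key : ∀ a : A, (Monoid.PushoutI.of true ((a : G) ^ n) : Monoid.PushoutI φ) =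
      Monoid.PushoutI.of false (a : G) := fun a =>
    (Monoid.PushoutI.of_apply_eq_base φ true a).trans
      (Monoid.PushoutI.of_apply_eq_base φ false a).symm
  refine ⟨Monoid.PushoutI φ, inferInstance,
    Monoid.PushoutI.listProd_surjective (φ := φ).countable,
    Monoid.PushoutI.of (φ := φ) false, Monoid.PushoutI.torsionFreeGroup hφ fun _ => hG,
    Monoid.PushoutI.of_injective hφ false, Monoid.PushoutI.of (φ := φ) true x, ?_, ?_⟩
  · rw [← map_pow]
    exact key x'
  · rw [← key f']
    exact (hfx.pow_left n).map _

/-! ### Permutational wreath products -/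

section PermutationalWreath

variable {G : Type*} [Group G]

/-- The action of a group on the finitely supported integral functions on a coset space. -/
noncomputable def cosetFunctionAction (K : Subgroup G) :
    G →* MulAut (Multiplicative ((G ⧸ K) →₀ ℤ)) where
  toFun g := AddEquiv.toMultiplicative (Finsupp.domCongr (MulAction.toPerm g))
  map_one' := by
    ext v
    simp
  map_mul' g h := by
    ext v
    simp [mul_smul]

/-- The restricted permutational wreath product of `ℤ` with a group acting on a coset space. -/
abbrev CosetWreath (K : Subgroup G) : Type _ :=
  Multiplicative ((G ⧸ K) →₀ ℤ) ⋊[cosetFunctionAction K] G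

namespace CosetWreath

variable {K : Subgroup G}

theorem toAdd_cosetFunctionAction_apply (g : G) (v : Multiplicative ((G ⧸ K) →₀ ℤ)) (q : G ⧸ K) :
    (cosetFunctionAction K g v).toAdd q = v.toAdd (g⁻¹ • q) := by
  simp [cosetFunctionAction]

theorem cosetFunctionAction_single (g : G) (q : G ⧸ K) :
    cosetFunctionAction K g (.ofAdd (Finsupp.single q 1)) = .ofAdd (Finsupp.single (g • q) 1) := by
  simp [cosetFunctionAction]

/-- Both the quotient `G` and the base group of integral functions are torsion-free. -/
theorem torsionFreeGroup (hG : TorsionFreeGroup G) (K : Subgroup G) :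
    TorsionFreeGroup (CosetWreath K) := by
  intro y hy n hn hyn
  have hr : y.right = 1 := by
    by_contra h
    refine hG y.right h n hn ?_
    rw [← SemidirectProduct.rightHom_eq_right, ← map_pow, hyn, map_one]
  have hy' : y = SemidirectProduct.inl y.left := by
    rw [← SemidirectProduct.inl_left_mul_inr_right y, hr]
    simp
  rw [hy', ← map_pow] at hyn
  have hpow : y.left ^ n = 1 := SemidirectProduct.inl_injective (hyn.trans (map_one _).symm)
  have h0 : n • y.left.toAdd = 0 := hpow
  have h1 : y.left.toAdd = 0 := (smul_eq_zero.1 h0).resolve_left hn.ne'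
  have h2 : y.left = 1 := h1
  exact hy (by rw [hy', h2, map_one])

instance [Countable G] (K : Subgroup G) : Countable (CosetWreath K) :=
  have : Countable (G ⧸ K) := QuotientGroup.mk_surjective.countable
  have : Countable (Multiplicative ((G ⧸ K) →₀ ℤ)) :=
    inferInstanceAs (Countable ((G ⧸ K) →₀ ℤ))
  SemidirectProduct.equivProd.injective.countable

/-- The generator of the base group at the trivial coset. -/
noncomputable def lamp (K : Subgroup G) : CosetWreath K :=
  SemidirectProduct.inl (.ofAdd (Finsupp.single ((1 : G) : G ⧸ K) 1))

theorem conj_lamp (g : G) :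
    SemidirectProduct.inr g * lamp K * (SemidirectProduct.inr g)⁻¹ =
      SemidirectProduct.inl (.ofAdd (Finsupp.single ((g : G) : G ⧸ K) 1)) := by
  rw [lamp, ← map_inv, ← SemidirectProduct.inl_aut, cosetFunctionAction_single]
  simp

/-- Conjugation by `g` moves the lamp from the coset `K` to `gK`. -/
theorem commute_inr_lamp_iff {g : G} :
    Commute (SemidirectProduct.inr g) (lamp K) ↔ g ∈ K := by
  rw [commute_iff_eq, ← mul_inv_eq_iff_eq_mul, conj_lamp, lamp, SemidirectProduct.inl_inj,
    Multiplicative.ofAdd.apply_eq_iff_eq, Finsupp.single_left_inj one_ne_zero, eq_comm,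
    QuotientGroup.eq]
  simp

/-- The subgroup of a wreath product over the cosets of `K` generated by `K` and by the functions
that vanish at the trivial coset. -/
def vanishing (K : Subgroup G) : Subgroup (CosetWreath K) where
  carrier := {y | y.right ∈ K ∧ y.left.toAdd ((1 : G) : G ⧸ K) = 0}
  one_mem' := by simp [one_mem]
  mul_mem' := by
    rintro y z ⟨hy, hy'⟩ ⟨hz, hz'⟩
    refine ⟨mul_mem hy hz, ?_⟩
    have : y.right⁻¹ • ((1 : G) : G ⧸ K) = ((1 : G) : G ⧸ K) := by
      simpa [MulAction.Quotient.smul_coe, QuotientGroup.eq] using hy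
    simp [toAdd_cosetFunctionAction_apply, hy', this, hz']
  inv_mem' := by
    rintro y ⟨hy, hy'⟩
    refine ⟨inv_mem hy, ?_⟩
    have : y.right • ((1 : G) : G ⧸ K) = ((1 : G) : G ⧸ K) := by
      simpa [MulAction.Quotient.smul_coe, QuotientGroup.eq] using hy
    rw [SemidirectProduct.inv_left, toAdd_cosetFunctionAction_apply]
    simp [this, hy']

/-- The commutator is the function `δ_K - δ_{hK}`, whose value at `K` is 1. -/
theorem commutator_lamp_notMem_vanishing {h : G} (hh : h ∉ K) :
    ⁅lamp K, (SemidirectProduct.inr h : CosetWreath K)⁆ ∉ vanishing K := by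
  have : ⁅lamp K, (SemidirectProduct.inr h : CosetWreath K)⁆ = SemidirectProduct.inl
      (Multiplicative.ofAdd
        (Finsupp.single ((1 : G) : G ⧸ K) (1 : ℤ) - Finsupp.single ((h : G) : G ⧸ K) 1)) := by
    rw [ofAdd_sub, map_div, ← conj_lamp h, ← lamp, commutatorElement_def, div_eq_mul_inv]
    simp only [mul_inv_rev, inv_inv, mul_assoc]
  rw [this]
  rintro ⟨-, h0⟩
  have hne : ((h : G) : G ⧸ K) ≠ ((1 : G) : G ⧸ K) := by
    rwa [ne_eq, eq_comm, QuotientGroup.eq, inv_one, one_mul]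
  rw [SemidirectProduct.left_inl, toAdd_ofAdd, Finsupp.sub_apply, Finsupp.single_eq_same,
    Finsupp.single_eq_of_ne hne.symm] at h0
  norm_num at h0

theorem inr_mem_vanishing {g : G} (hg : g ∈ K) : SemidirectProduct.inr g ∈ vanishing K :=
  ⟨hg, by simp⟩

/-- The base part of the conjugate is `g • u - u`, and `g` fixes the trivial coset. -/
theorem conj_inr_mem_vanishing {g : G} (hg : g ∈ K) {u : CosetWreath K} (hu : u.right = 1) :
    u⁻¹ * SemidirectProduct.inr g * u ∈ vanishing K := by
  have : g⁻¹ • ((1 : G) : G ⧸ K) = ((1 : G) : G ⧸ K) := by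
    simpa [MulAction.Quotient.smul_coe, QuotientGroup.eq] using hg
  refine ⟨by simpa [hu] using hg, ?_⟩
  simp [toAdd_cosetFunctionAction_apply, hu, this]

end CosetWreath

end PermutationalWreath

open CosetWreath in
/-- If `h` is not a power of `f`, then a torsion-free extension has elements `a`, `b` as in the
definition of algebraic disjointness from `f`. -/
theorem TorsionFreeGroup.exists_commutator_extension {G : Type} [Group G] [Countable G]
    (hG : TorsionFreeGroup G) {f h : G} (hfh : h ∉ Subgroup.zpowers f) :
    ∃ (H : Type) (_ : Group H) (_ : Countable H) (i : G →* H),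
      TorsionFreeGroup H ∧ Function.Injective i ∧
        ∃ a b : H, Commute a (i f) ∧ Commute b (i f) ∧ ⁅a, ⁅b, i h⁆⁆ ≠ 1 ∧
          Commute ⁅a, ⁅b, i h⁆⁆ (i f) := by
  have hf := Subgroup.mem_zpowers f
  let K := Subgroup.zpowers f
  -- The first lamp plays the role of `b`, so `u` is the inner commutator. The second lamp `a`
  -- commutes with exactly those elements of the first wreath product that lie in `vanishing K`:
  -- this contains `f` and `u⁻¹ f u`, but not `u`.
  let u : CosetWreath K := ⁅lamp K, SemidirectProduct.inr h⁆
  let f₁ : CosetWreath K := SemidirectProduct.inr f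
  let j : CosetWreath K →* CosetWreath (vanishing K) := SemidirectProduct.inr
  let a := lamp (vanishing K)
  have hu : u.right = 1 := by simp [u, commutatorElement_def, lamp]
  have ha : Commute (j f₁) a := commute_inr_lamp_iff.2 (inr_mem_vanishing hf)
  have ha' : Commute (j (u⁻¹ * f₁ * u)) a := commute_inr_lamp_iff.2 (conj_inr_mem_vanishing hf hu)
  have hb : Commute f₁ (lamp K) := commute_inr_lamp_iff.2 hf
  have hju : ⁅j (lamp K), j (SemidirectProduct.inr h)⁆ = j u := (map_commutatorElement j _ _).symm
  refine ⟨CosetWreath (vanishing K), inferInstance, inferInstance,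
    j.comp SemidirectProduct.inr,
    torsionFreeGroup (torsionFreeGroup hG _) _,
    SemidirectProduct.inr_injective.comp SemidirectProduct.inr_injective,
    a, j (lamp K), ha.symm, (hb.map j).symm, ?_, ?_⟩
  · simp only [MonoidHom.comp_apply]
    rw [hju, ne_eq, commutatorElement_eq_one_iff_commute]
    exact fun hc => commutator_lamp_notMem_vanishing hfh (commute_inr_lamp_iff.1 hc.symm)
  · simp only [MonoidHom.comp_apply]
    -- Split the commutator as `a` times `u a⁻¹ u⁻¹`; the latter commutes with `f` because `a`
    -- commutes with `u⁻¹ f u`.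
    rw [hju, commutatorElement_def, mul_assoc, mul_assoc]
    refine ha.symm.mul_left ?_
    have h1 := (Commute.conj_iff (j u)).2 ha'.inv_right.symm
    have h2 : j u * j (u⁻¹ * f₁ * u) * (j u)⁻¹ = j f₁ := by
      rw [← map_mul, ← map_inv, ← map_mul]
      congr 1
      group
    rw [h2] at h1
    simpa [mul_assoc] using h1

/-! ### The topology of enumerated groups -/

open Filter Topology

namespace EnumeratedGroup

/-- A natural number as an element of an enumerated group. -/
def elt (G : EnumeratedGroup) (n : ℕ) : G.Carrier := n

/-- The natural number underlying an element of an enumerated group. -/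
def index {G : EnumeratedGroup} (x : G.Carrier) : ℕ := x

/-- The enumerated group transported along an enumeration of a group. -/
def ofEquiv {H : Type*} [Group H] (e : ℕ ≃ H) : EnumeratedGroup where
  val := ⟨fun p => e.symm (e p.1 * e p.2), fun n => e.symm (e n)⁻¹, e.symm 1⟩
  property := by constructor <;> simp [mul_assoc]

/-- The transported group is isomorphic to the original one. -/
def ofEquivMulEquiv {H : Type*} [Group H] (e : ℕ ≃ H) : (ofEquiv e).Carrier ≃* H where
  toEquiv := e
  map_mul' a b := e.apply_symm_apply (e a * e b)

variable {X : Type*} [TopologicalSpace X] {F : X → EnumeratedGroup}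

/-- The arguments `u` and `v` are locally constant, so locally this evaluates the table at a fixed
entry. -/
theorem continuous_mul (hF : Continuous F) {u v : X → ℕ} (hu : Continuous u) (hv : Continuous v) :
    Continuous fun x => (F x).1.1 (u x, v x) := by
  rw [continuous_iff_continuousAt]
  intro x
  have h1 : ∀ᶠ y in 𝓝 x, u y = u x :=
    hu.continuousAt.eventually_mem
      (IsOpen.mem_nhds (isOpen_discrete {u x}) rfl)
  have h2 : ∀ᶠ y in 𝓝 x, v y = v x :=
    hv.continuousAt.eventually_mem
      (IsOpen.mem_nhds (isOpen_discrete {v x}) rfl)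
  have h3 : Continuous fun y => (F y).1.1 (u x, v x) := by fun_prop
  refine h3.continuousAt.congr ?_
  filter_upwards [h1, h2] with y hy hy'
  rw [hy, hy']

theorem continuous_inv (hF : Continuous F) {u : X → ℕ} (hu : Continuous u) :
    Continuous fun x => (F x).1.2.1 (u x) := by
  rw [continuous_iff_continuousAt]
  intro x
  have h1 : ∀ᶠ y in 𝓝 x, u y = u x :=
    hu.continuousAt.eventually_mem
      (IsOpen.mem_nhds (isOpen_discrete {u x}) rfl)
  have h3 : Continuous fun y => (F y).1.2.1 (u x) := by fun_prop
  refine h3.continuousAt.congr ?_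
  filter_upwards [h1] with y hy
  rw [hy]

theorem continuous_one (hF : Continuous F) : Continuous fun x => (F x).1.2.2 := by
  fun_prop

theorem continuous_commutator (hF : Continuous F) {u v : X → ℕ} (hu : Continuous u)
    (hv : Continuous v) :
    Continuous fun x => index ⁅(F x).elt (u x), (F x).elt (v x)⁆ :=
  continuous_mul hF (continuous_mul hF (continuous_mul hF hu hv) (continuous_inv hF hu))
    (continuous_inv hF hv)

theorem continuous_pow (hF : Continuous F) {u : X → ℕ} (hu : Continuous u) (n : ℕ) :
    Continuous fun x => index ((F x).elt (u x) ^ n) := by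
  induction n with
  | zero => exact (continuous_one hF).congr fun x => (pow_zero ((F x).elt (u x))).symm
  | succ n ih =>
    exact (continuous_mul hF ih hu).congr fun x => (pow_succ ((F x).elt (u x)) n).symm

theorem continuous_zpow (hF : Continuous F) {u : X → ℕ} (hu : Continuous u) (n : ℤ) :
    Continuous fun x => index ((F x).elt (u x) ^ n) := by
  cases n with
  | ofNat n =>
    exact (continuous_pow hF hu n).congr fun x =>
      (zpow_natCast ((F x).elt (u x)) n).symm
  | negSucc n =>
    exact (continuous_inv hF (continuous_pow hF hu (n + 1))).congr fun x =>
      (zpow_negSucc ((F x).elt (u x)) n).symm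

end EnumeratedGroup

theorem isOpen_setOf_eq_of_discrete {X Y : Type*} [TopologicalSpace X] [TopologicalSpace Y]
    [DiscreteTopology Y] {u v : X → Y} (hu : Continuous u) (hv : Continuous v) :
    IsOpen {x | u x = v x} :=
  (isOpen_discrete {p : Y × Y | p.1 = p.2}).preimage (hu.prodMk hv)

theorem isOpen_setOf_ne_of_discrete {X Y : Type*} [TopologicalSpace X] [TopologicalSpace Y]
    [DiscreteTopology Y] {u v : X → Y} (hu : Continuous u) (hv : Continuous v) :
    IsOpen {x | u x ≠ v x} :=
  (isOpen_discrete {p : Y × Y | p.1 ≠ p.2}).preimage (hu.prodMk hv)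

theorem isOpen_setOf_exists {X : Type*} {ι : Sort*} [TopologicalSpace X] {p : ι → X → Prop}
    (h : ∀ i, IsOpen {x | p i x}) : IsOpen {x | ∃ i, p i x} := by
  rw [Set.ofPred_exists]
  exact isOpen_iUnion h

theorem TorsionFreeGroup.of_mulEquiv {G H : Type*} [Group G] [Group H] (e : G ≃* H)
    (hH : TorsionFreeGroup H) : TorsionFreeGroup G := by
  intro x hx n hn h
  exact hH (e x) (by simpa using hx) n hn (by rw [← map_pow, h, map_one])

theorem exists_finset_of_mem_nhds {X : Type*} {s : Set (X → ℕ)} {x : X → ℕ} (hs : s ∈ 𝓝 x) :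
    ∃ I : Finset X, ∀ y : X → ℕ, (∀ i ∈ I, y i = x i) → y ∈ s := by
  rw [nhds_pi, Filter.mem_pi'] at hs
  obtain ⟨I, t, ht, hts⟩ := hs
  refine ⟨I, fun y hy => hts fun i hi => ?_⟩
  rw [hy i hi]
  exact mem_of_mem_nhds (ht i)

/-- Near an enumerated torsion-free group there are enumerations of each of its countable
torsion-free extensions, compatible on a given finite set. -/
theorem TorsionFreeEnumeratedGroup.exists_mem_nhds_extension (G : TorsionFreeEnumeratedGroup)
    {U : Set TorsionFreeEnumeratedGroup} (hU : U ∈ 𝓝 G) (T : Finset ℕ)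
    {H : Type} [Group H] [Countable H] (hH : TorsionFreeGroup H) (i : G.1.Carrier →* H)
    (hi : Function.Injective i) :
    ∃ G' ∈ U, ∃ e : G'.1.Carrier ≃* H, ∀ n ∈ T, e n = i n := by
  classical
  have hind : Topology.IsInducing
      (fun G : TorsionFreeEnumeratedGroup => (G.1.1 : GroupData)) :=
    Topology.IsInducing.subtypeVal.comp Topology.IsInducing.subtypeVal
  rw [hind.nhds_eq_comap, mem_comap] at hU
  obtain ⟨V, hV, hVU⟩ := hU
  rw [nhds_prod_eq, nhds_prod_eq, mem_prod_iff] at hV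
  obtain ⟨M, hM, V', hV', hMV⟩ := hV
  obtain ⟨N, hN, O, hO, hNO⟩ := mem_prod_iff.1 hV'
  obtain ⟨I, hI⟩ := exists_finset_of_mem_nhds hM
  obtain ⟨J, hJ⟩ := exists_finset_of_mem_nhds hN
  -- `S` contains the arguments and the values of all table entries that the neighbourhood
  -- constrains; a bijection `ℕ ≃ H` that agrees with `i` on `S` reproduces these entries.
  let S : Finset ℕ := T ∪ (I.image Prod.fst ∪ I.image Prod.snd ∪ I.image G.1.1.1) ∪
    (J ∪ J.image G.1.1.2.1) ∪ {G.1.1.2.2}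
  let i' : ℕ → H := i
  have hi' : Function.Injective i' := hi
  have : Infinite H := Infinite.of_injective i' hi'
  obtain ⟨e, he⟩ := Cardinal.extend_function_of_lt (α := ℕ) (β := H) (s := (S : Set ℕ))
    ⟨fun n => i' n, hi'.comp Subtype.val_injective⟩
    ((Cardinal.lt_aleph0_of_finite _).trans_eq Cardinal.mk_nat.symm)
    (nonempty_equiv_of_countable)
  have heS : ∀ n ∈ S, e n = i' n := fun n hn => he ⟨n, hn⟩
  refine ⟨⟨EnumeratedGroup.ofEquiv e,
    hH.of_mulEquiv (EnumeratedGroup.ofEquivMulEquiv e)⟩, hVU (hMV ⟨hI _ ?_, hNO ⟨hJ _ ?_, ?_⟩⟩),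
    EnumeratedGroup.ofEquivMulEquiv e, fun n hn => heS n (by simp [S, hn])⟩
  · rintro ⟨a, b⟩ hab
    have ha : a ∈ S := by
      have := Finset.mem_image_of_mem Prod.fst hab
      simp only [S, Finset.mem_union]; tauto
    have hb : b ∈ S := by
      have := Finset.mem_image_of_mem Prod.snd hab
      simp only [S, Finset.mem_union]; tauto
    have hc : G.1.1.1 (a, b) ∈ S := by
      have := Finset.mem_image_of_mem G.1.1.1 hab
      simp only [S, Finset.mem_union]; tauto
    change e.symm (e a * e b) = G.1.1.1 (a, b)
    rw [Equiv.symm_apply_eq, heS a ha, heS b hb, heS _ hc]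
    exact (map_mul i (G.1.elt a) (G.1.elt b)).symm
  · intro a ha'
    have ha : a ∈ S := by
      simp only [S, Finset.mem_union]; tauto
    have hc : G.1.1.2.1 a ∈ S := by
      have := Finset.mem_image_of_mem G.1.1.2.1 ha'
      simp only [S, Finset.mem_union]; tauto
    change e.symm (e a)⁻¹ = G.1.1.2.1 a
    rw [Equiv.symm_apply_eq, heS a ha, heS _ hc]
    exact (map_inv i (G.1.elt a)).symm
  · have hc : G.1.1.2.2 ∈ S := by simp [S]
    have : e.symm 1 = G.1.1.2.2 := by
      rw [Equiv.symm_apply_eq, heS _ hc]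
      exact (map_one i).symm
    change e.symm 1 ∈ O
    rw [this]
    exact mem_of_mem_nhds hO

/-! ### Generic existence of roots and commutators -/

section Generic

open EnumeratedGroup

theorem continuous_enumeratedGroup :
    Continuous fun G : TorsionFreeEnumeratedGroup => G.1 :=
  continuous_subtype_val

/-- A condition on two elements that is open and holds in some torsion-free extension of any
countable torsion-free group holds for all pairs of elements of a generic group. -/
theorem eventually_residual_of_extension {P : ∀ (G : Type) [Group G], G → G → Prop}
    (hopen : ∀ a b : ℕ,
      IsOpen {G : TorsionFreeEnumeratedGroup | P G.1.Carrier (G.1.elt a) (G.1.elt b)})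
    (hiso : ∀ (G H : Type) [Group G] [Group H] (e : G ≃* H) (a b : G),
      P H (e a) (e b) → P G a b)
    (hext : ∀ (G : Type) [Group G] [Countable G], TorsionFreeGroup G → ∀ a b : G,
      ∃ (H : Type) (_ : Group H) (_ : Countable H) (i : G →* H),
        TorsionFreeGroup H ∧ Function.Injective i ∧ P H (i a) (i b)) :
    ∀ᶠ G : TorsionFreeEnumeratedGroup in residual _, ∀ a b : G.1.Carrier, P G.1.Carrier a b := by
  suffices h : ∀ᶠ G : TorsionFreeEnumeratedGroup in residual _, ∀ a b : ℕ,
      P G.1.Carrier (G.1.elt a) (G.1.elt b) from h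
  refine eventually_countable_forall.2 fun a => eventually_countable_forall.2 fun b => ?_
  refine residual_of_dense_open (hopen a b) ?_
  intro G
  rw [mem_closure_iff_nhds]
  intro U hU
  have : Countable G.1.Carrier := inferInstanceAs (Countable ℕ)
  obtain ⟨H, _, _, i, hH, hi, hP⟩ := hext G.1.Carrier G.2 (G.1.elt a) (G.1.elt b)
  obtain ⟨G', hG', e, he⟩ :=
    TorsionFreeEnumeratedGroup.exists_mem_nhds_extension G hU {a, b} hH i hi
  refine ⟨G', hG', hiso _ _ e _ _ ?_⟩
  have ha : e (G'.1.elt a) = i (G.1.elt a) := he a (by simp)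
  have hb : e (G'.1.elt b) = i (G.1.elt b) := he b (by simp)
  rwa [ha, hb]

/-- In a generic group, commuting elements `f`, `x` admit an `n`-th root of `x` commuting with
`f`. -/
theorem eventually_exists_root {n : ℕ} (hn : 0 < n) :
    ∀ᶠ G : TorsionFreeEnumeratedGroup in residual _, ∀ f x : G.1.Carrier,
      ⁅f, x⁆ ≠ 1 ∨ ∃ y, y ^ n = x ∧ ⁅f, y⁆ = 1 := by
  refine eventually_residual_of_extension
    (P := fun G _ f x => ⁅f, x⁆ ≠ 1 ∨ ∃ y, y ^ n = x ∧ ⁅f, y⁆ = 1) ?_ ?_ ?_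
  · intro f x
    have hF := continuous_enumeratedGroup
    have h1 := continuous_one hF
    refine IsOpen.union (isOpen_setOf_ne_of_discrete
      (continuous_commutator hF continuous_const continuous_const) h1) ?_
    have : ∀ y : ℕ, IsOpen {G : TorsionFreeEnumeratedGroup |
        G.1.elt y ^ n = G.1.elt x ∧ ⁅G.1.elt f, G.1.elt y⁆ = 1} := fun y =>
      (isOpen_setOf_eq_of_discrete (continuous_pow hF continuous_const n) continuous_const).inter
        (isOpen_setOf_eq_of_discrete (continuous_commutator hF continuous_const continuous_const) h1)
    have hopen := isOpen_setOf_exists this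
    exact hopen
  · rintro G H _ _ e f x (h | ⟨y, hy, h⟩)
    · left
      rw [← map_commutatorElement] at h
      exact fun h' => h (by rw [h', map_one])
    · right
      refine ⟨e.symm y, e.injective ?_, e.injective ?_⟩
      · simp [hy]
      · rw [map_commutatorElement]
        simp [h]
  · intro G _ _ hG f x
    by_cases hfx : Commute f x
    · obtain ⟨H, _, _, i, hH, hi, y, hy, hc⟩ := hG.exists_root_extension hfx hn
      exact ⟨H, _, ‹_›, i, hH, hi, Or.inr ⟨y, hy, commutatorElement_eq_one_iff_commute.2 hc⟩⟩
    · exact ⟨G, _, ‹_›, .id G, hG, Function.injective_id,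
        Or.inl fun h => hfx (commutatorElement_eq_one_iff_commute.1 h)⟩

/-- In a generic group, an element `h` that is not a power of `f` has a nontrivial commutator
`⁅a, ⁅b, h⁆⁆` commuting with `f`, for some `a`, `b` commuting with `f`. -/
theorem eventually_exists_commutator :
    ∀ᶠ G : TorsionFreeEnumeratedGroup in residual _, ∀ f h : G.1.Carrier,
      (∃ k : ℤ, f ^ k = h) ∨ ∃ a b : G.1.Carrier, (⁅a, f⁆ = 1 ∧ ⁅b, f⁆ = 1) ∧
        (⁅a, ⁅b, h⁆⁆ ≠ 1 ∧ ⁅⁅a, ⁅b, h⁆⁆, f⁆ = 1) := by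
  refine eventually_residual_of_extension
    (P := fun G _ f h => (∃ k : ℤ, f ^ k = h) ∨ ∃ a b : G, (⁅a, f⁆ = 1 ∧ ⁅b, f⁆ = 1) ∧
        (⁅a, ⁅b, h⁆⁆ ≠ 1 ∧ ⁅⁅a, ⁅b, h⁆⁆, f⁆ = 1)) ?_ ?_ ?_
  · intro f h
    have hF := continuous_enumeratedGroup
    have h1 := continuous_one hF
    refine IsOpen.union ?_ ?_
    · have : ∀ k : ℤ, IsOpen {G : TorsionFreeEnumeratedGroup |
          G.1.elt f ^ k = G.1.elt h} := fun k =>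
        isOpen_setOf_eq_of_discrete (continuous_zpow hF continuous_const k) continuous_const
      have hopen := isOpen_setOf_exists this
      exact hopen
    · have hcc : ∀ a b : ℕ, Continuous fun G : TorsionFreeEnumeratedGroup =>
          index ⁅G.1.elt a, ⁅G.1.elt b, G.1.elt h⁆⁆ := fun a b =>
        continuous_commutator hF continuous_const
          (continuous_commutator hF continuous_const continuous_const)
      have : ∀ a b : ℕ, IsOpen {G : TorsionFreeEnumeratedGroup |
          (⁅G.1.elt a, G.1.elt f⁆ = 1 ∧ ⁅G.1.elt b, G.1.elt f⁆ = 1) ∧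
          (⁅G.1.elt a, ⁅G.1.elt b, G.1.elt h⁆⁆ ≠ 1 ∧
            ⁅⁅G.1.elt a, ⁅G.1.elt b, G.1.elt h⁆⁆, G.1.elt f⁆ = 1)} := fun a b =>
        ((isOpen_setOf_eq_of_discrete (continuous_commutator hF continuous_const continuous_const)
          h1).inter (isOpen_setOf_eq_of_discrete
            (continuous_commutator hF continuous_const continuous_const) h1)).inter
        ((isOpen_setOf_ne_of_discrete (hcc a b) h1).inter
          (isOpen_setOf_eq_of_discrete (continuous_commutator hF (hcc a b) continuous_const) h1))
      have hopen := isOpen_setOf_exists fun a => isOpen_setOf_exists (this a)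
      exact hopen
  · rintro G H _ _ e f h (⟨k, hk⟩ | ⟨a, b, ⟨ha, hb⟩, hne, hc⟩)
    · exact Or.inl ⟨k, e.injective (by rw [map_zpow, hk])⟩
    · right
      obtain ⟨a, rfl⟩ := e.surjective a
      obtain ⟨b, rfl⟩ := e.surjective b
      simp only [← map_commutatorElement, map_eq_one_iff e e.injective, ne_eq] at ha hb hne hc
      exact ⟨a, b, ⟨ha, hb⟩, hne, hc⟩
  · intro G _ _ hG f h
    by_cases hfh : h ∈ Subgroup.zpowers f
    · exact ⟨G, _, ‹_›, .id G, hG, Function.injective_id, Or.inl hfh⟩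
    · obtain ⟨H, _, _, i, hH, hi, a, b, ha, hb, hne, hc⟩ := hG.exists_commutator_extension hfh
      simp only [← commutatorElement_eq_one_iff_commute] at ha hb hc
      exact ⟨H, _, ‹_›, i, hH, hi, Or.inr ⟨a, b, ⟨ha, hb⟩, hne, hc⟩⟩

end Generic

/-! ### Centralizers and algebraic disjointness -/

theorem mem_centralizer_singleton_iff_commutator {G : Type*} [Group G] {f x : G} :
    x ∈ Subgroup.centralizer {f} ↔ ⁅x, f⁆ = 1 := by
  rw [Subgroup.mem_centralizer_singleton_iff, commutatorElement_eq_one_iff_mul_comm, eq_comm]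

/-- Otherwise `h = g ^ n` could be tested, but each `b` centralizing `g` has `⁅b, g ^ n⁆ = 1`, which
kills the outer commutator. -/
theorem AlgebraicallyDisjointFrom.commutator_pow_eq_one {G : Type*} [Group G] {f g : G}
    (h : AlgebraicallyDisjointFrom g f) (n : ℕ) : ⁅f, g ^ n⁆ = 1 := by
  by_contra hne
  obtain ⟨a, -, b, hb, hab, -⟩ := h (g ^ n) hne
  have hb : Commute b g :=
    commutatorElement_eq_one_iff_commute.1 (mem_centralizer_singleton_iff_commutator.1 hb)
  rw [commutatorElement_eq_one_iff_commute.2 (hb.pow_right n)] at hab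
  simp at hab

theorem proposition4p2 :
    GenericTorsionFree fun (G : Type) [Group G] =>
      (∀ f g : G, f ≠ 1 → g ≠ 1 → ⁅f, g⁆ = 1 → AlgebraicallyDisjointFrom f g) ∧
      (∀ f : G, rubinSet f = (Subgroup.centralizer {f} : Set G)) := by
  unfold GenericTorsionFree
  filter_upwards [eventually_exists_root (n := 12) (by norm_num), eventually_exists_commutator]
    with G hroot hcomm
  have hdisj : ∀ f g : G.1.Carrier, ⁅f, g⁆ = 1 → AlgebraicallyDisjointFrom f g := by
    intro f g hfg h hgh
    rcases hcomm f h with ⟨k, rfl⟩ | ⟨a, b, ⟨ha, hb⟩, hne, hc⟩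
    · rw [commutatorElement_eq_one_iff_commute] at hfg
      exact absurd (commutatorElement_eq_one_iff_commute.2 (hfg.symm.zpow_right k)) hgh
    · simp only [mem_centralizer_singleton_iff_commutator]
      exact ⟨a, ha, b, hb, hne, hc⟩
  refine ⟨fun f g _ _ => hdisj f g, fun f => Set.ext fun x => ⟨?_, fun hx => ?_⟩⟩
  · rintro ⟨g, hg, rfl⟩
    rw [SetLike.mem_coe, mem_centralizer_singleton_iff_commutator,
      commutatorElement_eq_one_iff_commute]
    exact (commutatorElement_eq_one_iff_commute.1 (hg.commutator_pow_eq_one 12)).symm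
  · rw [SetLike.mem_coe, mem_centralizer_singleton_iff_commutator,
      commutatorElement_eq_one_iff_commute] at hx
    rcases hroot f x with h | ⟨y, hy, hfy⟩
    · exact absurd (commutatorElement_eq_one_iff_commute.2 hx.symm) h
    · refine ⟨y, hdisj y f ?_, hy⟩
      rw [commutatorElement_eq_one_iff_commute] at hfy ⊢
      exact hfy.symm
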